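/- A dimension function is a nondecreasing, right-continuous function $h:[0,\infty)\to[0,\infty)$ with $h(0)=0$ and $h(t)>0$ for $t>0$. The Hausdorff outer measure associated with $h$ is $$\mathcal H^h(E)=\lim_{\delta\to0}\inf\Big\{\sum_i h(|U_i|): E\subseteq\bigcup_{i\in\mathbb N} U_i,\ |U_i|\le\delta\Big\},$$ where $|U|$ denotes the (Euclidean) diameter of $U$ (with the convention $|\emptyset|=0$). Let $s\ge 1$ and $m\ge2$ be integers, and let $h$ be a dimension function with $h\prec x^{2s}$, i.e. $\lim_{x\to0^+}x^{2s}/h(x)=0$. Let $(\psi_k)_{k\in\mathbb N}$ be a sequence of non-zero $\mathbb R$-linear maps $\psi_k:\mathbb C^{ms}=(\mathbb C^s)^m\to\mathbb C$. Then there exists a compact set $E\subseteq\mathbb C^s$ with $\mathcal H^h(E)>0$ such that $\psi_k(x_1,\dots,x_m)\ne0$ for all $k\in\mathbb N$ and all pairwise distinct $x_1,\dots,x_m\in E$. -/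

import Mathlib

open Filter Topology MeasureTheory
open scoped NNReal ENNReal

/-- Dimension functions: nondecreasing right-continuous `h : [0, ∞) → [0, ∞)` which vanish at `0`
and are positive on `(0, ∞)`. -/
structure IsDimensionFunction (h : ℝ≥0 → ℝ≥0) : Prop where
  map_zero : h 0 = 0
  pos : ∀ t, 0 < t → 0 < h t
  mono : Monotone h
  rightCont : ∀ t, ContinuousWithinAt h (Set.Ici t) t

/-- `DimPrec h₂ h₁` is the relation `h₂ ≺ h₁`, i.e. `h₁ x / h₂ x → 0` as `x → 0⁺`. -/
def DimPrec (h₂ h₁ : ℝ≥0 → ℝ≥0) : Prop :=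
  Tendsto (fun x => h₁ x / h₂ x) (𝓝[>] 0) (𝓝 0)

/-- The Hausdorff outer measure of a dimension function `h`: the limit as `δ → 0` of the infimum of
`∑ i, h (diam (U i))` over countable covers by sets of diameter at most `δ`. -/
noncomputable def hausdorffOuter {X : Type*} [EMetricSpace X] (h : ℝ≥0 → ℝ≥0) : OuterMeasure X :=
  OuterMeasure.mkMetric fun r : ℝ≥0∞ => if r = ∞ then ∞ else (h r.toNNReal : ℝ≥0∞)

/-! Taking a real or imaginary part reduces the problem to functionals `∑ j, a j (x j)` with
real-valued `a j`, not all zero. By second countability, distinct points lie in disjoint basic open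
sets, so countably many pairs (functional, tuple of basic open sets) have to be treated, one per
stage.

Start with Lebesgue measure on the unit ball. For a disjoint tuple `B`, keep in `B j` only the thin
slabs where `⌊a j x / ε⌋` has a prescribed residue modulo `D = 4 * m`, and multiply the remaining
mass by `D`. Suitable residues keep the sum away from `0` (`sum_ne_zero_of_mem_closedSlab`). As `ε →
0` the slabs equidistribute, so the new measure converges setwise to the old one, hence is bounded
by it up to an arbitrarily small thickening and additive error
(`eventually_forall_measure_le_thickening`).

The `n`-th measure is at most `D ^ n` times Lebesgue measure. Since `r ^ d / h r → 0` with `d` the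
real dimension, this factor is harmless below a scale `δ n`, and the errors of later stages are
chosen negligible there. Thus sets of small diameter `r` have mass at most `2 * h r` at every stage,
and a mass distribution principle applies. Compactness lets it use the finite stages directly,
without a limit measure. -/

/-! ### Equidistribution of thin slabs. -/

section Equidistribution

variable {V : Type*} [NormedAddCommGroup V] [NormedSpace ℝ V]

/-- The set of points `x` such that `ℓ x / ε` lies in an interval `[n, n + 1)` with
`n ≡ c` modulo `D`. -/
def slab (D : ℕ) (ℓ : V →L[ℝ] ℝ) (c : ℤ) (ε : ℝ) : Set V :=
  {x | (D : ℤ) ∣ ⌊ℓ x / ε⌋ - c}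

theorem measurableSet_slab [MeasurableSpace V] [BorelSpace V] (D : ℕ) (ℓ : V →L[ℝ] ℝ) (c : ℤ)
    (ε : ℝ) : MeasurableSet (slab D ℓ c ε) := by
  have h : Measurable fun x : V => ⌊ℓ x / ε⌋ - c :=
    ((ℓ.continuous.measurable.div_const ε).floor).sub_const c
  exact h (MeasurableSet.of_discrete (s := {n : ℤ | (D : ℤ) ∣ n}))

theorem slab_add_one (D : ℕ) (ℓ : V →L[ℝ] ℝ) (c : ℤ) {ε : ℝ} (hε : ε ≠ 0) {v : V} (hv : ℓ v = 1) :
    (fun x => x + ε • v) ⁻¹' slab D ℓ (c + 1) ε = slab D ℓ c ε := by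
  ext x
  have : ℓ (x + ε • v) / ε = ℓ x / ε + 1 := by
    rw [map_add, map_smul, hv, smul_eq_mul, mul_one, add_div, div_self hε]
  simp only [slab, Set.mem_preimage, Set.mem_ofPred_eq, this, Int.floor_add_one]
  ring_nf

theorem existsUnique_slab {D : ℕ} (hD : 0 < D) (ℓ : V →L[ℝ] ℝ) (c : ℤ) (ε : ℝ) (x : V) :
    ∃! k : ℕ, k < D ∧ x ∈ slab D ℓ (c + k) ε := by
  have hD' : (0 : ℤ) < D := by exact_mod_cast hD
  set n := ⌊ℓ x / ε⌋ - c with hn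
  refine ⟨(n % D).toNat, ⟨?_, ?_⟩, ?_⟩
  · have := Int.emod_lt_of_pos n hD'
    have := Int.emod_nonneg n hD'.ne'
    omega
  · have h0 := Int.emod_nonneg n hD'.ne'
    simp only [slab, Set.mem_ofPred_eq, Int.toNat_of_nonneg h0]
    rw [show ⌊ℓ x / ε⌋ - (c + n % D) = n - n % D by rw [hn]; ring]
    exact Int.dvd_self_sub_emod
  · rintro k ⟨hk, hx⟩
    simp only [slab, Set.mem_ofPred_eq] at hx
    have : n % D = k := by
      rw [show ⌊ℓ x / ε⌋ - (c + (k : ℤ)) = n - k by rw [hn]; ring] at hx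
      rw [Int.emod_eq_emod_iff_emod_sub_eq_zero.2 (Int.emod_eq_zero_of_dvd hx)]
      exact Int.emod_eq_of_lt (by positivity) (by exact_mod_cast hk)
    omega

/-- A measure is equidistributed modulo `D` if, in the limit `ε → 0`, each slab carries the
proportion `1 / D` of the mass of every measurable set. -/
def Equidistributed [MeasurableSpace V] (D : ℕ) (ν : Measure V) : Prop :=
  ∀ ℓ : V →L[ℝ] ℝ, ℓ ≠ 0 → ∀ (c : ℤ) (A : Set V), MeasurableSet A →
    Tendsto (fun ε => (D : ℝ≥0∞) * ν (A ∩ slab D ℓ c ε)) (𝓝[>] 0) (𝓝 (ν A))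

variable [MeasurableSpace V]

theorem Equidistributed.add {D : ℕ} {ν ν' : Measure V} (h : Equidistributed D ν)
    (h' : Equidistributed D ν') : Equidistributed D (ν + ν') := by
  intro ℓ hℓ c A hA
  simpa [mul_add] using (h ℓ hℓ c A hA).add (h' ℓ hℓ c A hA)

theorem Equidistributed.zero (D : ℕ) : Equidistributed D (0 : Measure V) := by
  intro ℓ hℓ c A hA
  simp

theorem Equidistributed.sum {ι : Type*} {D : ℕ} {ν : ι → Measure V} (J : Finset ι)
    (h : ∀ j ∈ J, Equidistributed D (ν j)) : Equidistributed D (∑ j ∈ J, ν j) :=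
  Finset.sum_induction _ _ (fun _ _ => Equidistributed.add) (Equidistributed.zero D) h

theorem Equidistributed.smul {D : ℕ} {ν : Measure V} (h : Equidistributed D ν) (k : ℕ) :
    Equidistributed D ((k : ℝ≥0∞) • ν) := by
  intro ℓ hℓ c A hA
  simpa [mul_left_comm] using
    ENNReal.Tendsto.const_mul (a := (k : ℝ≥0∞)) (h ℓ hℓ c A hA) (Or.inr (by simp))

theorem Equidistributed.restrict [BorelSpace V] {D : ℕ} {ν : Measure V} (h : Equidistributed D ν)
    {S : Set V} (hS : MeasurableSet S) : Equidistributed D (ν.restrict S) := by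
  intro ℓ hℓ c A hA
  have := h ℓ hℓ c (A ∩ S) (hA.inter hS)
  rw [Measure.restrict_apply hA]
  refine this.congr fun ε => ?_
  rw [Measure.restrict_apply (hA.inter (measurableSet_slab D ℓ c ε)), Set.inter_right_comm]

/-- Translation by `ε • v` with `ℓ v = 1` preserves `μ` and carries each slab to the next. It
changes `A` only by a set whose measure tends to `0`, by continuity of translation in measure. -/
theorem tendsto_measureReal_slab_sub [FiniteDimensional ℝ V] [BorelSpace V] (μ : Measure V)
    [μ.IsAddHaarMeasure] (D : ℕ) {ℓ : V →L[ℝ] ℝ} (hℓ : ℓ ≠ 0) (c : ℤ) {A : Set V}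
    (hA : MeasurableSet A) (hμA : μ A ≠ ∞) :
    Tendsto (fun ε => μ.real (A ∩ slab D ℓ (c + 1) ε) - μ.real (A ∩ slab D ℓ c ε))
      (𝓝[>] 0) (𝓝 0) := by
  obtain ⟨v, hv⟩ : ∃ v, ℓ v = 1 := by
    obtain ⟨w, hw⟩ : ∃ w, ℓ w ≠ 0 := by
      by_contra! h
      exact hℓ (ContinuousLinearMap.ext h)
    exact ⟨(ℓ w)⁻¹ • w, by simp [hw]⟩
  let f : ℝ → C(V, V) := fun ε => ⟨fun x => x + ε • v, by fun_prop⟩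
  have hf : Continuous f := by
    refine ContinuousMap.continuous_of_continuous_uncurry _ ?_
    change Continuous fun p : ℝ × V => p.2 + p.1 • v
    fun_prop
  have hpres : ∀ ε, MeasurePreserving (f ε) μ μ := fun ε => measurePreserving_add_right μ (ε • v)
  have h0 := tendsto_measure_symmDiff_preimage_nhds_zero (μ := μ) (ν := μ) (hf.tendsto 0)
    (.of_forall hpres) (hpres 0) hA.nullMeasurableSet hμA
  have h1 : Tendsto (fun ε => μ.real (symmDiff (f ε ⁻¹' A) A)) (𝓝[>] 0) (𝓝 0) := by
    have e : (f 0) ⁻¹' A = A := by ext x; simp [f]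
    rw [e] at h0
    exact
      (ENNReal.tendsto_toReal ENNReal.zero_ne_top).comp (h0.mono_left nhdsWithin_le_nhds)
  refine squeeze_zero_norm' ?_ h1
  filter_upwards [self_mem_nhdsWithin] with ε hε
  have hε' : ε ≠ 0 := ne_of_gt hε
  have e1 : μ.real (A ∩ slab D ℓ (c + 1) ε) = μ.real (f ε ⁻¹' A ∩ slab D ℓ c ε) := by
    rw [← slab_add_one D ℓ c hε' hv]
    have := (hpres ε).measure_preimage
      (hA.inter (measurableSet_slab D ℓ (c + 1) ε)).nullMeasurableSet
    rw [Measure.real, ← this]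
    rfl
  rw [e1, Real.norm_eq_abs]
  have hfA : μ (f ε ⁻¹' A) ≠ ∞ := by
    rwa [(hpres ε).measure_preimage hA.nullMeasurableSet]
  have hS := measurableSet_slab D ℓ c ε
  have hfm : MeasurableSet (f ε ⁻¹' A) := (hpres ε).measurable hA
  refine (abs_measureReal_sub_le_measureReal_symmDiff'
    (hfm.inter hS).nullMeasurableSet (hA.inter hS).nullMeasurableSet ?_ ?_).trans ?_
  · exact measure_ne_top_of_subset Set.inter_subset_left hfA
  · exact measure_ne_top_of_subset Set.inter_subset_left hμA
  · refine measureReal_mono ?_ ?_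
    · intro x hx
      simp only [Set.mem_symmDiff, Set.mem_inter_iff] at hx ⊢
      tauto
    · refine measure_ne_top_of_subset (Set.union_subset_union Set.sdiff_subset Set.sdiff_subset) ?_
      exact (measure_union_lt_top hfA.lt_top hμA.lt_top).ne

/-- The `D` residue classes partition `A`, and their masses are asymptotically equal. -/
theorem tendsto_mul_measureReal_slab [FiniteDimensional ℝ V] [BorelSpace V] (μ : Measure V)
    [μ.IsAddHaarMeasure] {D : ℕ} (hD : 0 < D) {ℓ : V →L[ℝ] ℝ} (hℓ : ℓ ≠ 0) (c : ℤ) {A : Set V}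
    (hA : MeasurableSet A) (hμA : μ A ≠ ∞) :
    Tendsto (fun ε => D * μ.real (A ∩ slab D ℓ c ε)) (𝓝[>] 0) (𝓝 (μ.real A)) := by
  have hk : ∀ k : ℕ, Tendsto
      (fun ε => μ.real (A ∩ slab D ℓ (c + k) ε) - μ.real (A ∩ slab D ℓ c ε)) (𝓝[>] 0) (𝓝 0) := by
    intro k
    induction k with
    | zero => simp
    | succ k ih =>
      have := (tendsto_measureReal_slab_sub μ D hℓ (c + k) hA hμA).add ih
      simpa [add_assoc] using this
  have hsum : ∀ ε, ∑ k ∈ Finset.range D, μ.real (A ∩ slab D ℓ (c + k) ε) = μ.real A := by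
    intro ε
    rw [← measureReal_biUnion_finset]
    · congr 1
      ext x
      simp only [Finset.mem_range, Set.mem_iUnion, Set.mem_inter_iff, exists_prop]
      obtain ⟨k, hk, -⟩ := existsUnique_slab hD ℓ c ε x
      exact ⟨fun ⟨_, _, h, _⟩ => h, fun h => ⟨k, hk.1, h, hk.2⟩⟩
    · intro i hi j hj hij
      refine Set.disjoint_left.2 fun x hx hx' => hij ?_
      exact (existsUnique_slab hD ℓ c ε x).unique ⟨Finset.mem_range.1 hi, hx.2⟩
        ⟨Finset.mem_range.1 hj, hx'.2⟩
    · exact fun k _ => hA.inter (measurableSet_slab D ℓ _ ε)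
  have := (tendsto_finsetSum (Finset.range D) fun k _ => hk k).const_sub (μ.real A)
  simp only [Finset.sum_const_zero, sub_zero] at this
  refine this.congr fun ε => ?_
  rw [Finset.sum_sub_distrib, hsum]
  simp

theorem equidistributed_addHaar_restrict [FiniteDimensional ℝ V] [BorelSpace V] (μ : Measure V)
    [μ.IsAddHaarMeasure] {D : ℕ} (hD : 0 < D) {K : Set V} (hK : MeasurableSet K)
    (hμK : μ K ≠ ∞) : Equidistributed D (μ.restrict K) := by
  intro ℓ hℓ c A hA
  have hμ : μ (A ∩ K) ≠ ∞ := measure_ne_top_of_subset Set.inter_subset_right hμK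
  have := ENNReal.tendsto_ofReal
    (tendsto_mul_measureReal_slab μ hD hℓ c (hA.inter hK) hμ)
  rw [ofReal_measureReal hμ, ← Measure.restrict_apply hA] at this
  refine this.congr fun ε => ?_
  rw [ENNReal.ofReal_mul (by positivity), ENNReal.ofReal_natCast, ofReal_measureReal
    (measure_ne_top_of_subset Set.inter_subset_left hμ),
    Measure.restrict_apply (hA.inter (measurableSet_slab D ℓ c ε)), Set.inter_right_comm]

end Equidistribution

/-! ### Avoiding one functional on one tuple of open sets. -/

section Step

open scoped Pointwise

theorem IsCompact.exists_measurable_partition {V : Type*} [PseudoMetricSpace V]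
    [MeasurableSpace V] [OpensMeasurableSpace V] {K : Set V} (hK : IsCompact K) {η : ℝ}
    (hη : 0 < η) :
    ∃ (N : ℕ) (P : ℕ → Set V), (∀ i, MeasurableSet (P i)) ∧ Pairwise (Function.onFun Disjoint P) ∧
      (K ⊆ ⋃ i ∈ Finset.range N, P i) ∧ ∀ i, ∀ x ∈ P i, ∀ y ∈ P i, dist x y < η := by
  rcases K.eq_empty_or_nonempty with rfl | ⟨x₀, -⟩
  · exact ⟨0, fun _ => ∅, by simp, fun i j _ => by simp [Function.onFun], by simp, by simp⟩
  obtain ⟨t, -, ht, htK⟩ := hK.finite_cover_balls (half_pos hη)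
  obtain ⟨N, e, he⟩ : ∃ (N : ℕ) (e : ℕ → V), ∀ x ∈ t, ∃ i < N, e i = x := by
    have := ht.fintype
    let E := Fintype.equivFin t
    refine ⟨Fintype.card t, fun i => if h : i < Fintype.card t then E.symm ⟨i, h⟩ else x₀, ?_⟩
    intro x hx
    exact ⟨E ⟨x, hx⟩, (E ⟨x, hx⟩).2, (dif_pos (E ⟨x, hx⟩).2).trans (by simp)⟩
  refine ⟨N, disjointed fun i => Metric.ball (e i) (η / 2), ?_, disjoint_disjointed _, ?_, ?_⟩
  · exact fun i => MeasurableSet.disjointed (fun _ => measurableSet_ball) i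
  · intro x hx
    obtain ⟨y, hy, hxy⟩ := Set.mem_iUnion₂.1 (htK hx)
    obtain ⟨i, hi, rfl⟩ := he y hy
    have h1 := le_partialSups (fun i => Metric.ball (e i) (η / 2)) i hxy
    rw [← partialSups_disjointed, partialSups_eq_biSup] at h1
    simp only [Set.iSup_eq_iUnion, Set.mem_iUnion] at h1
    obtain ⟨j, hj, hx⟩ := h1
    exact Set.mem_iUnion₂.2 ⟨j, Finset.mem_range.2 (hj.trans_lt hi), hx⟩
  · intro i x hx y hy
    have hx := disjointed_subset _ i hx
    have hy := disjointed_subset _ i hy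
    rw [Metric.mem_ball] at hx hy
    have := dist_triangle_right x y (e i)
    linarith

/-- Setwise convergence becomes a bound uniform in `U` because `K` is covered by finitely many
pieces of diameter less than `η`: the pieces meeting `U` lie in its thickening. -/
theorem eventually_forall_measure_le_thickening {V ι : Type*} [PseudoMetricSpace V]
    [MeasurableSpace V] [OpensMeasurableSpace V] {K : Set V} (hK : IsCompact K) {ν : Measure V}
    [IsFiniteMeasure ν] {ν' : ι → Measure V} {l : Filter ι} (hν' : ∀ i, ν' i Kᶜ = 0)
    (h : ∀ A, MeasurableSet A → Tendsto (fun i => ν' i A) l (𝓝 (ν A))) {η : ℝ} (hη : 0 < η) :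
    ∀ᶠ i in l, ∀ U, ν' i U ≤ ν (Metric.thickening η U) + ENNReal.ofReal η := by
  classical
  obtain ⟨N, P, hPm, hPd, hPK, hP⟩ := hK.exists_measurable_partition hη
  -- The error is shared among `N` pieces; `N + 1` avoids division by zero.
  set η' : ℝ≥0∞ := ENNReal.ofReal η / (N + 1 : ℕ) with hη'
  have hη'0 : η' ≠ 0 := by simp [hη', hη]
  have hev : ∀ᶠ i in l, ∀ n ∈ Finset.range N, ν' i (P n) ≤ ν (P n) + η' := by
    rw [Filter.eventually_all_finset]
    intro n _
    exact ((h _ (hPm n)).eventually_lt_const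
      (ENNReal.lt_add_right (measure_ne_top ν _) hη'0)).mono fun _ => le_of_lt
  filter_upwards [hev] with i hi U
  set T := (Finset.range N).filter fun n => (P n ∩ U).Nonempty with hT
  have hsub : U ⊆ Kᶜ ∪ ⋃ n ∈ T, P n := by
    intro x hx
    by_cases hxK : x ∈ K
    · obtain ⟨n, hn, hxn⟩ := Set.mem_iUnion₂.1 (hPK hxK)
      exact Or.inr (Set.mem_iUnion₂.2 ⟨n, Finset.mem_filter.2 ⟨hn, x, hxn, hx⟩, hxn⟩)
    · exact Or.inl hxK
  calc ν' i U ≤ ν' i Kᶜ + ν' i (⋃ n ∈ T, P n) := (measure_mono hsub).trans (measure_union_le _ _)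
    _ ≤ ∑ n ∈ T, ν' i (P n) := by
        rw [hν', zero_add]
        exact measure_biUnion_finset_le _ _
    _ ≤ ∑ n ∈ T, (ν (P n) + η') :=
        Finset.sum_le_sum fun n hn => hi n (Finset.mem_filter.1 hn).1
    _ = ν (⋃ n ∈ T, P n) + T.card * η' := by
        rw [Finset.sum_add_distrib, measure_biUnion_finset (fun a _ b _ hab => hPd hab)
          fun n _ => hPm n, Finset.sum_const, nsmul_eq_mul]
    _ ≤ ν (Metric.thickening η U) + ENNReal.ofReal η := by
        gcongr
        · intro x hx
          obtain ⟨n, hn, hxn⟩ := Set.mem_iUnion₂.1 hx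
          obtain ⟨y, hyn, hyU⟩ := (Finset.mem_filter.1 hn).2
          exact Metric.mem_thickening_iff.2 ⟨y, hyU, hP n x hxn y hyn⟩
        · have hc : T.card ≤ N + 1 :=
            (Finset.card_filter_le _ _).trans (by simp)
          calc (T.card : ℝ≥0∞) * η' ≤ (N + 1 : ℕ) * η' := by gcongr
            _ = ENNReal.ofReal η := ENNReal.mul_div_cancel (by simp) (by simp)

variable {V : Type*} [NormedAddCommGroup V] [NormedSpace ℝ V]

/-- The closed set of real numbers lying in an interval `[n, n + 1]` with `n ≡ c` modulo `D`. -/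
def closedSlab (D : ℕ) (c : ℤ) : Set ℝ :=
  ((↑) : ℤ → ℝ) '' {n : ℤ | (D : ℤ) ∣ n - c} + Set.Icc (0 : ℝ) 1

theorem isClosed_closedSlab (D : ℕ) (c : ℤ) : IsClosed (closedSlab D c) :=
  (Int.isClosedEmbedding_coe_real.isClosedMap _ (isClosed_discrete _)).add_right_of_isCompact
    isCompact_Icc

theorem mem_closedSlab_of_mem_slab {D : ℕ} {ℓ : V →L[ℝ] ℝ} {c : ℤ} {ε : ℝ} {x : V}
    (hx : x ∈ slab D ℓ c ε) : ℓ x / ε ∈ closedSlab D c :=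
  Set.mem_add.2 ⟨_, ⟨_, hx, rfl⟩, Int.fract (ℓ x / ε),
    ⟨Int.fract_nonneg _, (Int.fract_lt_one _).le⟩, Int.floor_add_fract _⟩

/-- The sum lies in `[4 * m * q + 2 * m, 4 * m * q + 3 * m]` for some integer `q`, an interval that
misses `0`. -/
theorem sum_ne_zero_of_mem_closedSlab {m : ℕ} (hm : 0 < m) (j₀ : Fin m) {t : Fin m → ℝ}
    (ht : ∀ j, t j ∈ closedSlab (4 * m) (if j = j₀ then 2 * m else 0)) : ∑ j, t j ≠ 0 := by
  choose u hu s hs hus using fun j => Set.mem_add.1 (ht j)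
  choose n hn hnu using hu
  choose k hk using hn
  intro h0
  have hsum : ∑ j, t j = ((4 * m * ∑ j, k j + 2 * m : ℤ) : ℝ) + ∑ j, s j := by
    have : ∑ j, n j = 4 * m * ∑ j, k j + 2 * m := by
      have e : ∀ j, n j = 4 * m * k j + if j = j₀ then 2 * (m : ℤ) else 0 := by
        intro j
        have := hk j
        push_cast at this
        linarith
      simp_rw [e, Finset.sum_add_distrib, Finset.mul_sum]
      simp
    rw [← this]
    simp_rw [← hus, Finset.sum_add_distrib, ← hnu]
    push_cast
    rfl
  have h1 : 0 ≤ ∑ j, s j := Finset.sum_nonneg fun j _ => (hs j).1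
  have h2 : ∑ j, s j ≤ m := by
    calc ∑ j, s j ≤ ∑ _j : Fin m, (1 : ℝ) := Finset.sum_le_sum fun j _ => (hs j).2
      _ = m := by simp
  rw [h0] at hsum
  set q := ∑ j, k j
  push_cast at hsum
  have hm' : (0 : ℝ) < m := by exact_mod_cast hm
  rcases le_or_gt 0 q with hq | hq
  · have : (0 : ℝ) ≤ q := by exact_mod_cast hq
    nlinarith [mul_nonneg hm'.le this]
  · have : (q : ℝ) ≤ -1 := by exact_mod_cast Int.le_sub_one_of_lt hq
    nlinarith [mul_nonneg hm'.le (by linarith : (0 : ℝ) ≤ -1 - q)]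

/-- One step of the construction of the Cantor set: a measure equidistributed modulo `4 * m` is
modified on disjoint open sets `B j` so that `∑ j, a j (x j)` does not vanish for points `x j ∈ B j`
of a closed set carrying the new measure. -/
theorem Equidistributed.exists_avoiding [MeasurableSpace V] [BorelSpace V]
    {m : ℕ} {K : Set V} (hK : IsCompact K)
    {ν : Measure V} [IsFiniteMeasure ν] (hν : Equidistributed (4 * m) ν) (hνK : ν Kᶜ = 0)
    {a : Fin m → V →L[ℝ] ℝ} (ha : ∃ j, a j ≠ 0) {B : Fin m → Set V} (hB : ∀ j, IsOpen (B j))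
    (hBd : Pairwise (Function.onFun Disjoint B)) {η : ℝ} (hη : 0 < η) :
    ∃ (ν' : Measure V) (F : Set V), IsFiniteMeasure ν' ∧ Equidistributed (4 * m) ν' ∧
      ν' ≤ ((4 * m : ℕ) : ℝ≥0∞) • ν ∧ IsClosed F ∧ ν' Fᶜ = 0 ∧
      (∀ x : Fin m → V, (∀ j, x j ∈ F ∩ B j) → ∑ j, a j (x j) ≠ 0) ∧
      (∀ U, ν' U ≤ ν (Metric.thickening η U) + ENNReal.ofReal η) ∧
      ν Set.univ ≤ ν' Set.univ + ENNReal.ofReal η := by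
  classical
  obtain ⟨j₀, hj₀⟩ := ha
  have hm : 0 < m := j₀.pos
  set D := 4 * m with hD
  have hD1 : (1 : ℝ≥0∞) ≤ (D : ℝ≥0∞) := by
    exact_mod_cast (by omega : 1 ≤ D)
  let c : Fin m → ℤ := fun j => if j = j₀ then 2 * m else 0
  -- Zero functionals do not equidistribute, so their sets `B j` are left untouched. They contribute
  -- `0`, which lies in the slab of residue `0`.
  let J : Finset (Fin m) := Finset.univ.filter fun j => a j ≠ 0
  let G : Set V := (⋃ j ∈ J, B j)ᶜ
  have hG : MeasurableSet G := (Finset.measurableSet_biUnion J fun j _ => (hB j).measurableSet).compl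
  have hdec : ∀ A, MeasurableSet A → ν (A ∩ G) + ∑ j ∈ J, ν (A ∩ B j) = ν A := by
    intro A hA
    rw [← measure_biUnion_finset, ← Set.inter_iUnion₂, add_comm, ← Set.sdiff_eq,
      measure_inter_add_sdiff₀]
    · exact (Finset.measurableSet_biUnion J fun j _ => (hB j).measurableSet).nullMeasurableSet
    · exact fun i _ j _ hij => (hBd hij).mono Set.inter_subset_right Set.inter_subset_right
    · exact fun j _ => hA.inter (hB j).measurableSet
  let S : ℝ → Fin m → Set V := fun ε j => B j ∩ slab D (a j) (c j) ε
  have hS : ∀ ε j, MeasurableSet (S ε j) := fun ε j =>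
    (hB j).measurableSet.inter (measurableSet_slab D (a j) (c j) ε)
  let ν' : ℝ → Measure V := fun ε => ν.restrict G + (D : ℝ≥0∞) • ∑ j ∈ J, ν.restrict (S ε j)
  have happ : ∀ ε A, MeasurableSet A →
      ν' ε A = ν (A ∩ G) + ∑ j ∈ J, D * ν ((A ∩ B j) ∩ slab D (a j) (c j) ε) := by
    intro ε A hA
    simp only [ν', Measure.add_apply, Measure.smul_apply, Measure.finsetSum_apply, smul_eq_mul,
      Measure.restrict_apply hA, Finset.mul_sum, S, Set.inter_assoc]
  have hle : ∀ ε, ν' ε ≤ (D : ℝ≥0∞) • ν := by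
    intro ε
    refine Measure.le_iff.2 fun A hA => ?_
    rw [happ ε A hA, Measure.smul_apply, smul_eq_mul, ← hdec A hA, mul_add, Finset.mul_sum]
    refine add_le_add (le_mul_of_one_le_left zero_le hD1) (Finset.sum_le_sum fun j _ => ?_)
    exact mul_le_mul_right (measure_mono Set.inter_subset_left) _
  have htend : ∀ A, MeasurableSet A → Tendsto (fun ε => ν' ε A) (𝓝[>] 0) (𝓝 (ν A)) := by
    intro A hA
    simp_rw [happ _ A hA]
    rw [← hdec A hA]
    refine tendsto_const_nhds.add (tendsto_finsetSum _ fun j hj => ?_)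
    exact hν (a j) (Finset.mem_filter.1 hj).2 (c j) _ (hA.inter (hB j).measurableSet)
  have hK' : ∀ ε, ν' ε Kᶜ = 0 := fun ε =>
    le_antisymm ((hle ε Kᶜ).trans (by simp [hνK])) zero_le
  have hev := eventually_forall_measure_le_thickening hK hK' htend hη
  have hev' : ∀ᶠ ε in 𝓝[>] (0 : ℝ), ν Set.univ ≤ ν' ε Set.univ + ENNReal.ofReal η := by
    have h1 := (htend _ MeasurableSet.univ).add_const (ENNReal.ofReal η)
    exact (h1.eventually_const_lt (ENNReal.lt_add_right (measure_ne_top ν _)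
      (by simpa using hη))).mono fun _ => le_of_lt
  obtain ⟨ε, hεU, hεm, -⟩ := (hev.and (hev'.and self_mem_nhdsWithin)).exists
  -- The half-open slabs are replaced by closed ones, and the condition is imposed only on the open
  -- `B j`, so the carrier is closed.
  refine ⟨ν' ε, {x | ∀ j ∈ J, x ∈ B j → a j x / ε ∈ closedSlab D (c j)}, ?_, ?_, hle ε, ?_, ?_, ?_,
    hεU, hεm⟩
  · refine ⟨(hle ε _).trans_lt ?_⟩
    simp [ENNReal.mul_lt_top_iff, measure_lt_top]
  · exact (hν.restrict hG).add ((Equidistributed.sum J fun j _ => hν.restrict (hS ε j)).smul D)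
  · simp only [Set.ofPred_forall]
    refine isClosed_biInter fun j _ => ?_
    have : {x | x ∈ B j → a j x / ε ∈ closedSlab D (c j)} =
        (B j)ᶜ ∪ (fun x => a j x / ε) ⁻¹' closedSlab D (c j) := by
      ext x
      simp [imp_iff_not_or]
    rw [this]
    exact (hB j).isClosed_compl.union ((isClosed_closedSlab D (c j)).preimage
      ((a j).continuous.div_const ε))
  · have hsub : {x | ∀ j ∈ J, x ∈ B j → a j x / ε ∈ closedSlab D (c j)}ᶜ ⊆
        (G ∪ ⋃ j ∈ J, S ε j)ᶜ := by
      refine Set.compl_subset_compl.2 ?_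
      rintro x (hx | hx) j hj hxj
      · exact absurd (Set.mem_iUnion₂.2 ⟨j, hj, hxj⟩) hx
      · obtain ⟨i, hi, hxi⟩ := Set.mem_iUnion₂.1 hx
        obtain rfl : i = j := by
          by_contra hij
          exact Set.disjoint_left.1 (hBd hij) hxi.1 hxj
        exact mem_closedSlab_of_mem_slab hxi.2
    refine measure_mono_null hsub ?_
    have hm : MeasurableSet (G ∪ ⋃ j ∈ J, S ε j)ᶜ :=
      (hG.union (Finset.measurableSet_biUnion J fun j _ => hS ε j)).compl
    have h1 : (G ∪ ⋃ j ∈ J, S ε j)ᶜ ∩ G = ∅ := by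
      ext x; simp; tauto
    have h2 : ∀ j ∈ J, (G ∪ ⋃ j ∈ J, S ε j)ᶜ ∩ S ε j = ∅ := by
      intro j hj
      refine Set.disjoint_iff_inter_eq_empty.1 (Set.disjoint_left.2 fun x hx hxj => hx ?_)
      exact Or.inr (Set.mem_iUnion₂.2 ⟨j, hj, hxj⟩)
    simp only [ν', Measure.add_apply, Measure.smul_apply, Measure.finsetSum_apply, smul_eq_mul,
      Measure.restrict_apply hm, h1]
    rw [Finset.sum_eq_zero fun j hj => by rw [h2 j hj, measure_empty]]
    simp
  · intro x hx
    have := sum_ne_zero_of_mem_closedSlab hm j₀ (t := fun j => a j (x j) / ε) fun j => by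
      by_cases hj : a j = 0
      · have hj' : j ≠ j₀ := fun e => hj₀ (e ▸ hj)
        simp only [hj, hj', if_false]
        exact Set.mem_add.2 ⟨0, ⟨0, by simp, by simp⟩, 0, by simp, by simp⟩
      · exact (hx j).1 j (Finset.mem_filter.2 ⟨Finset.mem_univ _, hj⟩) (hx j).2
    rw [← Finset.sum_div] at this
    exact fun h => this (by rw [h, zero_div])

end Step

/-! ### Mass distribution principle. -/

section Hausdorff

/-- A mass distribution principle for the intersection of a compact set with a sequence of closed
sets, in terms of measures carried by the finite intersections. -/
theorem hausdorffOuter_pos_of_measure_le {X : Type*} [MetricSpace X] [MeasurableSpace X]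
    {h : ℝ≥0 → ℝ≥0} (hh : IsDimensionFunction h) {K : Set X} (hK : IsCompact K)
    {F : ℕ → Set X} (hF : ∀ n, IsClosed (F n)) {ν : ℕ → Measure X}
    (hνK : ∀ N, ν N Kᶜ = 0) (hνF : ∀ N, ∀ i < N, ν N (F i)ᶜ = 0)
    {c : ℝ≥0∞} (hc : c ≠ 0) (hνc : ∀ N, 4 * c ≤ ν N Set.univ) {δ : ℝ≥0} (hδ : 0 < δ)
    (hνh : ∀ N (U : Set X) (r : ℝ≥0), 0 < r → r ≤ δ → Metric.ediam U ≤ r → ν N U ≤ 2 * h r) :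
    0 < hausdorffOuter h (K ∩ ⋂ n, F n) := by
  set g : ℝ≥0∞ → ℝ≥0∞ := fun r => if r = ∞ then ∞ else (h r.toNNReal : ℝ≥0∞) with hg
  have hδ2 : (0 : ℝ≥0∞) < (δ / 2 : ℝ≥0) := by simpa using hδ.ne'
  refine lt_of_lt_of_le (pos_iff_ne_zero.2 hc) (le_trans ?_
    (le_iSup₂_of_le (f := fun (r : ℝ≥0∞) (_ : r > 0) =>
      OuterMeasure.mkMetric'.pre (fun s : Set X => g (Metric.ediam s)) r)
      ((δ / 2 : ℝ≥0) : ℝ≥0∞) hδ2 le_rfl (K ∩ ⋂ n, F n)))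
  rw [OuterMeasure.mkMetric'.pre, OuterMeasure.boundedBy_apply]
  refine le_iInf₂ fun t ht => ?_
  set w : ℕ → ℝ≥0∞ := fun n => ⨆ _ : (t n).Nonempty,
    extend (fun (s : Set X) (_ : Metric.ediam s ≤ (δ / 2 : ℝ≥0)) => g (Metric.ediam s)) (t n) with hw
  -- The factor `4` in `hνc` pays for the `2` in `hνh` and for two amounts below `c`: the cost of
  -- the cover and the total cost `∑ e n` of making it open.
  by_contra! hlt
  obtain ⟨e, he, hesum⟩ := ENNReal.exists_pos_sum_of_countable' hc ℕ
  have hW : ∀ n, ∃ W : Set X, IsOpen W ∧ t n ⊆ W ∧ ∀ N, ν N W ≤ 2 * (w n + e n) := by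
    intro n
    rcases (t n).eq_empty_or_nonempty with h0 | h0
    · exact ⟨∅, isOpen_empty, h0.le, by simp⟩
    have hwt : w n = extend (fun (s : Set X) (_ : Metric.ediam s ≤ (δ / 2 : ℝ≥0)) =>
        g (Metric.ediam s)) (t n) := by simp only [hw, h0, iSup_pos]
    by_cases hd : Metric.ediam (t n) ≤ (δ / 2 : ℝ≥0)
    · have hd' : Metric.ediam (t n) ≠ ∞ := ne_top_of_le_ne_top ENNReal.coe_ne_top hd
      set r := (Metric.ediam (t n)).toNNReal with hr
      have hrd : (r : ℝ≥0∞) = Metric.ediam (t n) := ENNReal.coe_toNNReal hd'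
      have hwn : w n = h r := by
        rw [hwt, extend_eq (fun (s : Set X) _ => g (Metric.ediam s)) hd]
        exact if_neg hd'
      have hrδ : r < δ := by
        rw [← hrd, ENNReal.coe_le_coe] at hd
        exact hd.trans_lt (NNReal.half_lt_self hδ.ne')
      -- Right-continuity of `h` allows a slightly larger diameter `r' < δ`, hence an open
      -- neighbourhood of `t n`, at extra cost below `e n`.
      have hcont : Tendsto (fun x => (h x : ℝ≥0∞)) (𝓝[>] r) (𝓝 (h r)) :=
        (ENNReal.tendsto_coe.2 (hh.rightCont r)).mono_left (nhdsWithin_mono _ Set.Ioi_subset_Ici_self)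
      obtain ⟨r', hr'h, hr'⟩ := ((hcont.eventually_lt_const
        (ENNReal.lt_add_right ENNReal.coe_ne_top (he n).ne')).and (Ioo_mem_nhdsGT hrδ)).exists
      refine ⟨Metric.thickening (((r' - r) / 2 : ℝ≥0) : ℝ) (t n), Metric.isOpen_thickening,
        Metric.self_subset_thickening ?_ _, fun N => ?_⟩
      · have : 0 < r' - r := tsub_pos_of_lt hr'.1
        exact_mod_cast half_pos this
      · refine (hνh N _ r' (lt_of_le_of_lt zero_le hr'.1) hr'.2.le ?_).trans ?_
        · refine (Metric.ediam_thickening_le _).trans ?_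
          rw [← hrd]
          norm_cast
          rw [mul_div_cancel₀ _ (two_ne_zero), add_tsub_cancel_of_le hr'.1.le]
        · rw [hwn]
          gcongr
    · refine ⟨Set.univ, isOpen_univ, Set.subset_univ _, fun N => ?_⟩
      -- A set of diameter exceeding `δ / 2` has infinite weight, so nothing has to be proved.
      have hwn : w n = ∞ := hwt.trans (iInf_neg hd)
      simp [hwn]
  choose W hWo htW hWν using hW
  have hempty : (K \ ⋃ n, W n) ∩ ⋂ n, F n = ∅ := by
    rw [Set.eq_empty_iff_forall_notMem]
    rintro x ⟨⟨hxK, hxW⟩, hxF⟩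
    exact hxW (Set.iUnion_mono htW (ht ⟨hxK, hxF⟩))
  -- By compactness, finitely many `F i` already lie with `K` inside the open cover. A single `ν N`
  -- is carried by all of them.
  obtain ⟨u, hu⟩ := (hK.diff (isOpen_iUnion hWo)).elim_finite_subfamily_closed F hF hempty
  obtain ⟨N, hN⟩ := u.exists_nat_subset_range
  have hcover : (Set.univ : Set X) ⊆ (Kᶜ ∪ ⋃ i ∈ u, (F i)ᶜ) ∪ ⋃ n, W n := by
    intro x _
    by_contra hx
    simp only [Set.mem_union, Set.mem_compl_iff, Set.mem_iUnion, not_or, not_exists, not_not,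
      exists_prop, not_and] at hx
    refine Set.eq_empty_iff_forall_notMem.1 hu x ⟨⟨hx.1.1, ?_⟩, Set.mem_iInter₂.2 hx.1.2⟩
    simpa using hx.2
  have h0 : ν N (Kᶜ ∪ ⋃ i ∈ u, (F i)ᶜ) = 0 := by
    refine measure_union_null (hνK N) ((measure_biUnion_null_iff u.countable_toSet).2 fun i hi => ?_)
    exact hνF N i (Finset.mem_range.1 (hN hi))
  have hfin : 4 * c ≤ 2 * (∑' n, w n + ∑' n, e n) :=
    calc 4 * c ≤ ν N Set.univ := hνc N
      _ ≤ ν N (Kᶜ ∪ ⋃ i ∈ u, (F i)ᶜ) + ν N (⋃ n, W n) :=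
          (measure_mono hcover).trans (measure_union_le _ _)
      _ ≤ ∑' n, ν N (W n) := by
          rw [h0, zero_add]
          exact measure_iUnion_le _
      _ ≤ ∑' n, 2 * (w n + e n) := ENNReal.tsum_le_tsum fun n => hWν n N
      _ = 2 * (∑' n, w n + ∑' n, e n) := by rw [ENNReal.tsum_mul_left, ENNReal.tsum_add]
  have h4 : 4 * c = 2 * (c + c) := by ring
  rw [h4, ENNReal.mul_le_mul_iff_right (by simp) (by simp)] at hfin
  exact absurd hfin (not_le.2 (ENNReal.add_lt_add hlt hesum))

end Hausdorff

/-! ### Iterating the step, and control across stages and scales. -/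

section Construction

variable {V : Type*} [NormedAddCommGroup V] [NormedSpace ℝ V] [MeasurableSpace V] [BorelSpace V]

theorem exists_seq_measure_avoiding {m : ℕ} {K : Set V} (hK : IsCompact K)
    {ν₀ : Measure V} [IsFiniteMeasure ν₀] (hν₀ : Equidistributed (4 * m) ν₀) (hνK : ν₀ Kᶜ = 0)
    {a : ℕ → Fin m → V →L[ℝ] ℝ} (ha : ∀ n, ∃ j, a n j ≠ 0) {B : ℕ → Fin m → Set V}
    (hB : ∀ n j, IsOpen (B n j)) {η : ℕ → ℝ} (hη : ∀ n, 0 < η n) :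
    ∃ (ν : ℕ → Measure V) (F : ℕ → Set V), ν 0 = ν₀ ∧
      (∀ n, ν (n + 1) ≤ ((4 * m : ℕ) : ℝ≥0∞) • ν n) ∧ (∀ n, IsClosed (F n)) ∧
      (∀ n, ν (n + 1) (F n)ᶜ = 0) ∧
      (∀ n, Pairwise (Function.onFun Disjoint (B n)) →
        ∀ x : Fin m → V, (∀ j, x j ∈ F n ∩ B n j) → ∑ j, a n j (x j) ≠ 0) ∧
      (∀ n U, ν (n + 1) U ≤ ν n (Metric.thickening (η n) U) + ENNReal.ofReal (η n)) ∧
      (∀ n, ν n Set.univ ≤ ν (n + 1) Set.univ + ENNReal.ofReal (η n)) := by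
  let X := {ν : Measure V // IsFiniteMeasure ν ∧ Equidistributed (4 * m) ν ∧ ν Kᶜ = 0}
  have hstep : ∀ n (ν : X), ∃ (ν' : X) (F : Set V), ν'.1 ≤ ((4 * m : ℕ) : ℝ≥0∞) • ν.1 ∧
      IsClosed F ∧ ν'.1 Fᶜ = 0 ∧ (Pairwise (Function.onFun Disjoint (B n)) →
        ∀ x : Fin m → V, (∀ j, x j ∈ F ∩ B n j) → ∑ j, a n j (x j) ≠ 0) ∧
      (∀ U, ν'.1 U ≤ ν.1 (Metric.thickening (η n) U) + ENNReal.ofReal (η n)) ∧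
      ν.1 Set.univ ≤ ν'.1 Set.univ + ENNReal.ofReal (η n) := by
    rintro n ⟨ν, hfin, hν, hνK⟩
    by_cases hd : Pairwise (Function.onFun Disjoint (B n))
    · obtain ⟨ν', F, h1, h2, h3, h4, h5, h6, h7, h8⟩ :=
        hν.exists_avoiding hK hνK (ha n) (hB n) hd (hη n)
      exact ⟨⟨ν', h1, h2, le_antisymm ((h3 _).trans (by simp [hνK])) zero_le⟩, F, h3, h4, h5,
        fun _ => h6, h7, h8⟩
    -- A tuple of sets that is not disjoint imposes no condition; the measure is kept.
    · refine ⟨⟨ν, hfin, hν, hνK⟩, Set.univ, ?_, isClosed_univ, by simp, fun h => absurd h hd,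
        fun U => ?_, le_self_add⟩
      · obtain ⟨j, -⟩ := ha n
        have hm := j.pos
        have h1 : (1 : ℝ≥0∞) ≤ (4 * m : ℕ) := by exact_mod_cast (by omega : 1 ≤ 4 * m)
        intro U
        exact le_mul_of_one_le_left zero_le h1
      · exact (measure_mono (Metric.self_subset_thickening (hη n) U)).trans le_self_add
  choose f F hf using hstep
  let ν : ℕ → X := fun n => Nat.rec ⟨ν₀, ‹_›, hν₀, hνK⟩ (fun n x => f n x) n
  exact ⟨fun n => (ν n).1, fun n => F n (ν n), rfl, fun n => (hf n (ν n)).1,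
    fun n => (hf n (ν n)).2.1, fun n => (hf n (ν n)).2.2.1, fun n => (hf n (ν n)).2.2.2.1,
    fun n => (hf n (ν n)).2.2.2.2.1, fun n => (hf n (ν n)).2.2.2.2.2⟩

/-- Thickening radii and additive errors both add up along the stages. The strict inequality keeps
`ρ` positive even when `j = N`, so that `U` lies in its thickening. -/
theorem measure_le_measure_thickening_of_le {X : Type*} [PseudoMetricSpace X] [MeasurableSpace X]
    {ν : ℕ → Measure X} {η : ℕ → ℝ} (hη : ∀ n, 0 < η n)
    (hν : ∀ n U, ν (n + 1) U ≤ ν n (Metric.thickening (η n) U) + ENNReal.ofReal (η n))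
    {j N : ℕ} (hjN : j ≤ N) {ρ : ℝ} (hρ : ∑ i ∈ Finset.Ico j N, η i < ρ) (U : Set X) :
    ν N U ≤ ν j (Metric.thickening ρ U) + ENNReal.ofReal ρ := by
  induction N, hjN using Nat.le_induction generalizing U ρ with
  | base =>
    rw [Finset.Ico_self, Finset.sum_empty] at hρ
    exact (measure_mono (Metric.self_subset_thickening hρ U)).trans le_self_add
  | succ N hN ih =>
    rw [Finset.sum_Ico_succ_top hN] at hρ
    have h0 : 0 ≤ ∑ i ∈ Finset.Ico j N, η i := Finset.sum_nonneg fun i _ => (hη i).le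
    have hρ' : ∑ i ∈ Finset.Ico j N, η i < ρ - η N := by linarith
    calc ν (N + 1) U ≤ ν N (Metric.thickening (η N) U) + ENNReal.ofReal (η N) := hν N U
      _ ≤ ν j (Metric.thickening (ρ - η N) (Metric.thickening (η N) U)) +
          ENNReal.ofReal (ρ - η N) + ENNReal.ofReal (η N) := by
        gcongr
        exact ih hρ' _
      _ ≤ ν j (Metric.thickening ρ U) + ENNReal.ofReal ρ := by
        rw [add_assoc, ← ENNReal.ofReal_add (by linarith) (hη N).le, sub_add_cancel]
        gcongr
        exact (Metric.thickening_thickening_subset _ _ _).trans_eq (by rw [sub_add_cancel])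

theorem measure_univ_le_add_sum {X : Type*} [MeasurableSpace X]
    {ν : ℕ → Measure X} {η : ℕ → ℝ} (hη : ∀ n, 0 < η n)
    (hν : ∀ n, ν n Set.univ ≤ ν (n + 1) Set.univ + ENNReal.ofReal (η n)) (N : ℕ) :
    ν 0 Set.univ ≤ ν N Set.univ + ENNReal.ofReal (∑ i ∈ Finset.range N, η i) := by
  induction N with
  | zero => simp
  | succ N ih =>
    rw [Finset.sum_range_succ, add_comm (∑ i ∈ Finset.range N, η i),
      ENNReal.ofReal_add (hη N).le (Finset.sum_nonneg fun i _ => (hη i).le), ← add_assoc]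
    exact ih.trans (by gcongr; exact hν N)

/-- A dimension function dominating `r ^ d` dominates any sequence of multiples of `r ^ d` along
suitable scales. -/
theorem DimPrec.exists_antitone_scales {h : ℝ≥0 → ℝ≥0} (hh : IsDimensionFunction h) {d : ℕ}
    (hprec : DimPrec h fun x => x ^ d) (C : ℕ → ℝ≥0) :
    ∃ δ : ℕ → ℝ≥0, Antitone δ ∧ (∀ n, 0 < δ n) ∧ Tendsto δ atTop (𝓝 0) ∧
      ∀ n r, 0 < r → r ≤ δ n → C n * r ^ d ≤ h r := by
  have hev : ∀ n, ∀ᶠ k : ℕ in atTop, ∀ r : ℝ≥0, 0 < r → r ≤ 1 / ((k : ℝ≥0) + 1) →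
      C n * r ^ d ≤ h r := by
    intro n
    have h1 : ∀ᶠ x : ℝ≥0 in 𝓝[>] 0, x ^ d / h x < (C n + 1)⁻¹ :=
      hprec.eventually_lt_const (by positivity)
    obtain ⟨u, hu, hu'⟩ := mem_nhdsGT_iff_exists_Ioo_subset.1 h1
    have h2 : ∀ᶠ k : ℕ in atTop, 1 / ((k : ℝ≥0) + 1) < u :=
      (tendsto_one_div_add_atTop_nhds_zero_nat (𝕜 := ℝ≥0)).eventually_lt_const hu
    filter_upwards [h2] with k hk r hr hrk
    have h3 : r ^ d / h r < (C n + 1)⁻¹ := hu' ⟨hr, hrk.trans_lt hk⟩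
    have hhr := hh.pos r hr
    rw [div_lt_iff₀ hhr, inv_mul_eq_div, lt_div_iff₀ (by positivity)] at h3
    calc C n * r ^ d ≤ r ^ d * (C n + 1) := by
          rw [mul_comm]; gcongr; exact le_self_add
      _ ≤ h r := h3.le
  obtain ⟨φ, hφ, hφP⟩ := extraction_forall_of_eventually hev
  refine ⟨fun n => 1 / ((φ n : ℝ≥0) + 1), ?_, fun n => by positivity, ?_, hφP⟩
  · intro i j hij
    have := hφ.monotone hij
    dsimp only
    gcongr
  · exact (tendsto_one_div_add_atTop_nhds_zero_nat (𝕜 := ℝ≥0)).comp hφ.tendsto_atTop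

end Construction

theorem sum_Ico_mul_half_pow_le {κ : ℕ → ℝ} (hκ : Antitone κ) (hκ0 : ∀ n, 0 < κ n) (j N : ℕ) :
    ∑ i ∈ Finset.Ico j N, κ i * (1 / 2) ^ (i + 2) ≤ κ j / 2 := by
  calc ∑ i ∈ Finset.Ico j N, κ i * (1 / 2) ^ (i + 2)
      ≤ ∑ i ∈ Finset.Ico j N, κ j * ((1 / 4) * (1 / 2) ^ i) := by
        refine Finset.sum_le_sum fun i hi => ?_
        rw [pow_add, show ((1 : ℝ) / 2) ^ i * (1 / 2) ^ 2 = 1 / 4 * (1 / 2) ^ i by ring]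
        exact mul_le_mul_of_nonneg_right (hκ (Finset.mem_Ico.1 hi).1) (by positivity)
    _ ≤ ∑ i ∈ Finset.range N, κ j * ((1 / 4) * (1 / 2) ^ i) := by
        refine Finset.sum_le_sum_of_subset_of_nonneg ?_ fun i _ _ => ?_
        · rw [Finset.range_eq_Ico]
          exact Finset.Ico_subset_Ico_left (Nat.zero_le _)
        · have := hκ0 j
          positivity
    _ = κ j * (1 / 4) * ∑ i ∈ Finset.range N, (1 / 2) ^ i := by
        rw [Finset.mul_sum]
        exact Finset.sum_congr rfl fun i _ => by ring
    _ ≤ κ j * (1 / 4) * 2 := by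
        have := hκ0 j
        gcongr
        exact sum_geometric_two_le N
    _ = κ j / 2 := by ring

/-! ### The compact set for real functionals. -/

section Avoiding

variable {V : Type*} [NormedAddCommGroup V] [NormedSpace ℝ V]

theorem Function.Injective.exists_mem_countableBasis_pairwise_disjoint {X ι : Type*}
    [TopologicalSpace X] [T2Space X] [SecondCountableTopology X] [Finite ι] {x : ι → X}
    (hx : Function.Injective x) :
    ∃ B : ι → TopologicalSpace.countableBasis X, (∀ i, x i ∈ (B i : Set X)) ∧
      Pairwise (Function.onFun Disjoint fun i => (B i : Set X)) := by
  obtain ⟨U, hU, hUd⟩ := (Set.finite_range x).t2_separation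
  have hb := TopologicalSpace.isBasis_countableBasis X
  choose B hB hxB hBU using fun i => hb.exists_subset_of_mem_open (hU (x i)).1 (hU (x i)).2
  refine ⟨fun i => ⟨B i, hB i⟩, hxB, fun i j hij => ?_⟩
  exact (hUd ⟨i, rfl⟩ ⟨j, rfl⟩ (hx.ne hij)).mono (hBU i) (hBU j)

theorem exists_isCompact_forall_sum_ne_zero [FiniteDimensional ℝ V] {m : ℕ}
    {h : ℝ≥0 → ℝ≥0} (hh : IsDimensionFunction h)
    (hprec : DimPrec h fun x => x ^ Module.finrank ℝ V)
    {a : ℕ → Fin m → V →L[ℝ] ℝ} (ha : ∀ k, ∃ j, a k j ≠ 0) :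
    ∃ E : Set V, IsCompact E ∧ 0 < hausdorffOuter h E ∧
      ∀ k, ∀ x : Fin m → V, (∀ i, x i ∈ E) → Function.Injective x → ∑ j, a k j (x j) ≠ 0 := by
  let _ : MeasurableSpace V := borel V
  have : BorelSpace V := ⟨rfl⟩
  have : ProperSpace V := FiniteDimensional.proper ℝ V
  let μ : Measure V := Measure.addHaar
  have hm : 0 < m := (ha 0).choose.pos
  set K : Set V := Metric.closedBall 0 1 with hKdef
  have hK : IsCompact K := isCompact_closedBall 0 1
  have hμK : μ K ≠ ∞ := hK.measure_lt_top.ne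
  have hμK0 : 0 < μ.real K :=
    ENNReal.toReal_pos (Metric.measure_closedBall_pos μ 0 one_pos).ne' hμK
  set D : ℕ := 4 * m with hD
  have hD1 : (1 : ℝ≥0∞) ≤ (D : ℝ≥0∞) := by
    exact_mod_cast (by omega : 1 ≤ D)
  set b : ℝ≥0 := (μ K).toNNReal with hb
  have hμb : ∀ (x : V) (r : ℝ≥0), μ (Metric.closedBall x (2 * r)) =
      ((2 ^ Module.finrank ℝ V * b * r ^ Module.finrank ℝ V : ℝ≥0) : ℝ≥0∞) := by
    intro x r
    rw [Measure.addHaar_closedBall' μ x (by positivity), ← hKdef, ← ENNReal.coe_toNNReal hμK, ← hb,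
      ENNReal.ofReal, ← ENNReal.coe_mul, ENNReal.coe_inj,
      show (2 * (r : ℝ)) ^ Module.finrank ℝ V = ((2 * r : ℝ≥0) ^ Module.finrank ℝ V : ℝ≥0) by
        push_cast; rfl, Real.toNNReal_coe, mul_pow]
    ring
  -- The constant is that of `D ^ n * μ` on a ball of radius `2 * r`, the size of a set of diameter
  -- `r` thickened by at most `r`.
  obtain ⟨δ, hδanti, hδ0, hδlim, hδ⟩ := hprec.exists_antitone_scales hh
    fun n => D ^ n * (2 ^ Module.finrank ℝ V * b)
  -- `κ j` bounds all errors from stage `j` on. For `r > δ (j + 1)`, its three bounds keep the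
  -- thickening radius below `r`, the additive error below `h r`, and the total loss of mass at most
  -- half of `μ K`.
  let κ : ℕ → ℝ := fun n => min (min (δ (n + 1)) (h (δ (n + 1)))) (μ.real K)
  have hκ0 : ∀ n, 0 < κ n := fun n =>
    lt_min (lt_min (hδ0 _) (hh.pos _ (hδ0 _))) hμK0
  have hκanti : Antitone κ := by
    intro i j hij
    have h1 : δ (j + 1) ≤ δ (i + 1) := hδanti (by omega)
    exact min_le_min (min_le_min h1 (hh.mono h1)) le_rfl
  let η : ℕ → ℝ := fun n => κ n * (1 / 2) ^ (n + 2)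
  have hη0 : ∀ n, 0 < η n := fun n => mul_pos (hκ0 n) (by positivity)
  let T := ℕ × (Fin m → TopologicalSpace.countableBasis V)
  have : Nonempty (TopologicalSpace.countableBasis V) :=
    ⟨((Function.injective_of_subsingleton
      (fun _ : Fin 1 => (0 : V))).exists_mem_countableBasis_pairwise_disjoint).choose 0⟩
  have : Countable (TopologicalSpace.countableBasis V) :=
    (TopologicalSpace.countable_countableBasis V).to_subtype
  obtain ⟨τ, hτ⟩ := exists_surjective_nat T
  have : IsFiniteMeasure (μ.restrict K) := ⟨by simpa using hμK.lt_top⟩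
  obtain ⟨ν, F, hν0, hνD, hF, hνF, hav, hth, hmass⟩ := exists_seq_measure_avoiding hK
    (equidistributed_addHaar_restrict μ (by omega : 0 < D) hK.measurableSet hμK)
    (by rw [Measure.restrict_apply hK.measurableSet.compl]; simp)
    (a := fun n => a (τ n).1) (fun n => ha _) (B := fun n j => ((τ n).2 j : Set V))
    (fun n j => TopologicalSpace.isOpen_of_mem_countableBasis ((τ n).2 j).2) hη0
  have hνK : ∀ n, ν n Kᶜ = 0 := by
    intro n
    induction n with
    | zero => rw [hν0, Measure.restrict_apply hK.measurableSet.compl]; simp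
    | succ n ih => exact le_antisymm ((hνD n _).trans (by simp [ih])) zero_le
  have hνF' : ∀ N, ∀ i < N, ν N (F i)ᶜ = 0 := by
    intro N i hi
    induction N, hi using Nat.le_induction with
    | base => exact hνF i
    -- Each measure is dominated by a multiple of the previous one, so null sets stay null.
    | succ N _ ih => exact le_antisymm ((hνD N _).trans (by simp [ih])) zero_le
  have hνμ : ∀ n U, ν n U ≤ D ^ n * μ U := by
    intro n
    induction n with
    | zero => intro U; rw [hν0]; simpa using Measure.restrict_apply_le K U
    | succ n ih =>
      intro U
      calc ν (n + 1) U ≤ D * ν n U := hνD n U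
        _ ≤ D * (D ^ n * μ U) := by gcongr; exact ih U
        _ = D ^ (n + 1) * μ U := by ring
  have hsmall : ∀ n x (r : ℝ≥0), 0 < r → r ≤ δ n → ∀ U ⊆ Metric.closedBall x (2 * r),
      (D : ℝ≥0∞) ^ n * μ U ≤ h r := by
    intro n x r hr hrδ U hU
    calc (D : ℝ≥0∞) ^ n * μ U ≤ D ^ n * μ (Metric.closedBall x (2 * r)) := by gcongr
      _ = ((D ^ n * (2 ^ Module.finrank ℝ V * b) * r ^ Module.finrank ℝ V : ℝ≥0) : ℝ≥0∞) := by
        rw [hμb]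
        push_cast
        ring
      _ ≤ h r := by exact_mod_cast hδ n r hr hrδ
  refine ⟨K ∩ ⋂ n, F n, hK.inter_right (isClosed_iInter hF), ?_, ?_⟩
  · refine hausdorffOuter_pos_of_measure_le hh hK hF hνK hνF'
      (c := ENNReal.ofReal (μ.real K / 8)) (by simpa using hμK0) ?_ (hδ0 0) ?_
    · intro N
      have h1 := measure_univ_le_add_sum hη0 hmass N
      have h2 : ∑ i ∈ Finset.range N, η i ≤ μ.real K / 2 := by
        rw [Finset.range_eq_Ico]
        exact (sum_Ico_mul_half_pow_le hκanti hκ0 0 N).trans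
          (div_le_div_of_nonneg_right (min_le_right _ _) zero_le_two)
      rw [hν0, Measure.restrict_apply_univ, ← ofReal_measureReal hμK] at h1
      have h3 := h1.trans (add_le_add_right (ENNReal.ofReal_le_ofReal h2) _)
      rw [show (4 : ℝ≥0∞) = ENNReal.ofReal 4 by simp, ← ENNReal.ofReal_mul (by norm_num),
        show 4 * (μ.real K / 8) = μ.real K - μ.real K / 2 by ring,
        ENNReal.ofReal_sub _ (by positivity)]
      exact tsub_le_iff_right.2 h3
    · intro N U r hr hrδ hUr
      rcases U.eq_empty_or_nonempty with rfl | ⟨x, hx⟩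
      · simp
      have hUx : ∀ y ∈ U, dist y x ≤ r := by
        intro y hy
        have := (Metric.edist_le_ediam_of_mem hy hx).trans hUr
        rwa [edist_nndist, ENNReal.coe_le_coe, ← NNReal.coe_le_coe, coe_nndist] at this
      have hex : ∃ n, δ n < r := (hδlim.eventually_lt_const hr).exists
      -- This selects the stage with `δ (j + 1) < r ≤ δ j`; the first index below `r` is not `0`
      -- because `r ≤ δ 0`.
      obtain ⟨j, hj⟩ : ∃ j, Nat.find hex = j + 1 := by
        refine Nat.exists_eq_succ_of_ne_zero fun h0 => ?_
        have := Nat.find_spec hex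
        rw [h0] at this
        exact absurd hrδ (not_le.2 this)
      have hj1 : δ (j + 1) < r := hj ▸ Nat.find_spec hex
      have hj2 : r ≤ δ j := not_lt.1 (Nat.find_min hex (by omega))
      have hκr : κ j ≤ r := (min_le_left _ _).trans ((min_le_left _ _).trans hj1.le)
      have hκh : κ j ≤ h r :=
        (min_le_left _ _).trans ((min_le_right _ _).trans (hh.mono hj1.le))
      -- Up to stage `j` the density bound `D ^ N ≤ D ^ j` suffices; later measures are compared
      -- with `ν j`.
      rcases le_total N j with hN | hN
      · calc ν N U ≤ D ^ N * μ U := hνμ N U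
          _ ≤ D ^ j * μ U := by gcongr
          _ ≤ h r := by
            refine hsmall j x r hr hj2 U fun y hy => ?_
            have := hUx y hy
            rw [Metric.mem_closedBall]
            linarith [r.coe_nonneg]
          _ ≤ 2 * h r := le_mul_of_one_le_left zero_le one_le_two
      · have hlt : ∑ i ∈ Finset.Ico j N, η i < κ j :=
          (sum_Ico_mul_half_pow_le hκanti hκ0 j N).trans_lt (half_lt_self (hκ0 j))
        calc ν N U ≤ ν j (Metric.thickening (κ j) U) + ENNReal.ofReal (κ j) :=
              measure_le_measure_thickening_of_le hη0 hth hN hlt U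
          _ ≤ h r + h r := by
            refine add_le_add ((hνμ j _).trans (hsmall j x r hr hj2 _ fun y hy => ?_)) ?_
            · obtain ⟨z, hz, hyz⟩ := Metric.mem_thickening_iff.1 hy
              rw [Metric.mem_closedBall]
              linarith [hUx z hz, dist_triangle y z x]
            · exact ENNReal.ofReal_le_of_le_toReal (by simpa using hκh)
          _ = 2 * h r := (two_mul _).symm
  · intro k x hx hinj
    obtain ⟨B, hxB, hBd⟩ := hinj.exists_mem_countableBasis_pairwise_disjoint
    obtain ⟨n, hn⟩ := hτ (k, B)
    have := hav n (by rw [hn]; exact hBd) x fun j =>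
      ⟨Set.mem_iInter.1 (hx j).2 n, by rw [hn]; exact hxB j⟩
    rwa [hn] at this

theorem exists_isCompact_forall_linearMap_ne_zero [FiniteDimensional ℝ V] {m : ℕ}
    {h : ℝ≥0 → ℝ≥0} (hh : IsDimensionFunction h)
    (hprec : DimPrec h fun x => x ^ Module.finrank ℝ V)
    {φ : ℕ → (Fin m → V) →ₗ[ℝ] ℝ} (hφ : ∀ k, φ k ≠ 0) :
    ∃ E : Set V, IsCompact E ∧ 0 < hausdorffOuter h E ∧
      ∀ k, ∀ x : Fin m → V, (∀ i, x i ∈ E) → Function.Injective x → φ k x ≠ 0 := by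
  let a : ℕ → Fin m → V →L[ℝ] ℝ := fun k j =>
    (φ k ∘ₗ LinearMap.single ℝ (fun _ => V) j).toContinuousLinearMap
  have hsum : ∀ k x, ∑ j, a k j (x j) = φ k x := by
    intro k x
    conv_rhs => rw [← Finset.univ_sum_single x, map_sum]
    rfl
  obtain ⟨E, hE, hE0, hav⟩ := exists_isCompact_forall_sum_ne_zero hh hprec (a := a) fun k => by
    by_contra! h0
    refine hφ k (LinearMap.ext fun x => ?_)
    rw [← hsum]
    simp [h0]
  exact ⟨E, hE, hE0, fun k x hx hinj => hsum k x ▸ hav k x hx hinj⟩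

end Avoiding

theorem mainTheorem9 (s m : ℕ) (hs : 1 ≤ s) (hm : 2 ≤ m)
    (h : ℝ≥0 → ℝ≥0) (hh : IsDimensionFunction h)
    (hprec : DimPrec h (fun x => x ^ (2 * s)))
    (ψ : ℕ → ((Fin m → EuclideanSpace ℂ (Fin s)) →ₗ[ℝ] ℂ)) (hψ : ∀ k, ψ k ≠ 0) :
    ∃ E : Set (EuclideanSpace ℂ (Fin s)), IsCompact E ∧ 0 < hausdorffOuter h E ∧
      ∀ k, ∀ x : Fin m → EuclideanSpace ℂ (Fin s),
        (∀ i, x i ∈ E) → Function.Injective x → ψ k x ≠ 0 := by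
  -- A nonzero complex-valued map has a nonzero real or imaginary part, and it suffices that this
  -- part does not vanish.
  have hfunc : ∀ k, ∃ p : ℂ →ₗ[ℝ] ℝ, p ∘ₗ ψ k ≠ 0 := by
    intro k
    by_contra! h0
    refine hψ k (LinearMap.ext fun x => Complex.ext ?_ ?_)
    · exact LinearMap.congr_fun (h0 Complex.reLm) x
    · exact LinearMap.congr_fun (h0 Complex.imLm) x
  choose p hp using hfunc
  have : FiniteDimensional ℝ (EuclideanSpace ℂ (Fin s)) :=
    FiniteDimensional.complexToReal (EuclideanSpace ℂ (Fin s))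
  have hd : Module.finrank ℝ (EuclideanSpace ℂ (Fin s)) = 2 * s := by
    have := finrank_real_of_complex (EuclideanSpace ℂ (Fin s))
    rwa [finrank_euclideanSpace_fin] at this
  obtain ⟨E, hE, hE0, hav⟩ := exists_isCompact_forall_linearMap_ne_zero hh (by rwa [hd]) hp
  refine ⟨E, hE, hE0, fun k x hx hinj h0 => hav k x hx hinj ?_⟩
  rw [LinearMap.comp_apply, h0, map_zero]
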